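/- Let $n=2m$ be a positive even integer, let $g_0$ be the Euclidean metric on $\mathbb{R}^n$, and let $g=e^{2w}g_0$ where $w\in C^\infty(\mathbb{R}^n)$ is rotationally symmetric, i.e. $w(x)$ depends only on $\|x\|$. Let $R_g$ be the scalar curvature and $dv_g=e^{nw}\,dx$ the volume measure of $g$, and let $$Q_g=e^{-nw}(-\Delta)^m w,\qquad \Delta=\sum_{i=1}^n\frac{\partial^2}{\partial x_i^2},$$ be the $Q$-curvature of $g$. Assume that (A1) $g$ is complete; (A2) $R_g\ge 0$ outside some compact subset of $\mathbb{R}^n$; (A3) $\int_{\mathbb{R}^n}|Q_g|\,dv_g<\infty$. Then $$C_n\int_{\mathbb{R}^n}Q_g\,dv_g\le 1,\qquad C_n=\frac{1}{((n-2)!!)^2\,|S^{n-1}|},$$ where $|S^{n-1}|$ is the volume of the unit sphere in $\mathbb{R}^n$, $(2k)!!=(2k)(2k-2)\cdots 2$ for $k\geq 1$, and $0!!=1$. -/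

import Mathlib

open MeasureTheory Filter Topology
open scoped ContDiff Manifold ENNReal

noncomputable section

/-- The Euclidean space `ℝⁿ`. -/
abbrev RSpace (n : ℕ) : Type := EuclideanSpace ℝ (Fin n)

/-- A metric tensor on `ℝⁿ`, given by its matrix of coefficients `g_{ij}(x)` in the standard
coordinates. -/
abbrev MetricField (n : ℕ) : Type := RSpace n → Matrix (Fin n) (Fin n) ℝ

/-- The metric `e^{2w} g₀` conformal to the Euclidean metric `g₀`. -/
def conformalMetric {n : ℕ} (w : RSpace n → ℝ) : MetricField n :=
  fun x => Real.exp (2 * w x) • (1 : Matrix (Fin n) (Fin n) ℝ)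

/-- The partial derivative `∂f/∂xᵢ`. -/
def partialDeriv {n : ℕ} (i : Fin n) (f : RSpace n → ℝ) (x : RSpace n) : ℝ :=
  fderiv ℝ f x (EuclideanSpace.single i 1)

/-- The Christoffel symbol `Γᵏᵢⱼ = ½ ∑ₗ gᵏˡ (∂ᵢ gⱼₗ + ∂ⱼ gᵢₗ - ∂ₗ gᵢⱼ)`. -/
def christoffelSymbol {n : ℕ} (g : MetricField n) (k i j : Fin n) (x : RSpace n) : ℝ :=
  (1 / 2) * ∑ l, (g x)⁻¹ k l *
    (partialDeriv i (fun y => g y j l) x + partialDeriv j (fun y => g y i l) x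
      - partialDeriv l (fun y => g y i j) x)

/-- The Ricci tensor
`Ricⱼₖ = ∑ᵢ (∂ᵢ Γⁱⱼₖ - ∂ⱼ Γⁱᵢₖ) + ∑ᵢₚ (Γⁱᵢₚ Γᵖⱼₖ - Γⁱⱼₚ Γᵖᵢₖ)`. -/
def ricciTensor {n : ℕ} (g : MetricField n) (j k : Fin n) (x : RSpace n) : ℝ :=
  (∑ i, (partialDeriv i (christoffelSymbol g i j k) x
      - partialDeriv j (christoffelSymbol g i i k) x))
    + ∑ i, ∑ p, (christoffelSymbol g i i p x * christoffelSymbol g p j k x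
      - christoffelSymbol g i j p x * christoffelSymbol g p i k x)

/-- The scalar curvature `R = ∑ⱼₖ gʲᵏ Ricⱼₖ`. -/
def scalarCurvature {n : ℕ} (g : MetricField n) (x : RSpace n) : ℝ :=
  ∑ j, ∑ k, (g x)⁻¹ j k * ricciTensor g j k x

/-- The volume measure `dv_g = √(det g) dx`. -/
def riemannianVolume {n : ℕ} (g : MetricField n) : Measure (RSpace n) :=
  volume.withDensity (fun x => ENNReal.ofReal (Real.sqrt (g x).det))

/-- The `g`-length `√(g_x(v, v))` of a tangent vector `v` at `x`. -/
def tangentLength {n : ℕ} (g : MetricField n) (x v : RSpace n) : ℝ≥0∞ :=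
  ENNReal.ofReal (Real.sqrt (∑ i, ∑ j, g x i j * v i * v j))

/-- The Riemannian distance of `g`: the infimum of the `g`-lengths of the `C¹` paths that join
the two points. -/
def metricEDist {n : ℕ} (g : MetricField n) (x y : RSpace n) : ℝ≥0∞ :=
  letI : ∀ z : RSpace n, ENorm (TangentSpace 𝓘(ℝ, RSpace n) z) :=
    fun z => ⟨fun v => tangentLength g z v⟩
  Manifold.riemannianEDist 𝓘(ℝ, RSpace n) x y

/-- Completeness of `g`: each Cauchy sequence for the Riemannian distance converges. -/
def IsCompleteMetric {n : ℕ} (g : MetricField n) : Prop :=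
  ∀ u : ℕ → RSpace n,
    (∀ ε : ℝ≥0∞, 0 < ε → ∃ N, ∀ i ≥ N, ∀ j ≥ N, metricEDist g (u i) (u j) < ε) →
      ∃ x, Tendsto (fun i => metricEDist g (u i) x) atTop (𝓝 0)

/-- The nonnegative Laplace operator `-∑ᵢ ∂²/∂xᵢ²` of the flat metric. -/
def posLaplacian {n : ℕ} (f : RSpace n → ℝ) : RSpace n → ℝ :=
  fun x => -(Laplacian.laplacian f x)

/-- The `Q`-curvature of `e^{2w} g₀` on `ℝⁿ`, `n = 2m`: `Q = e^{-nw} (-∑ᵢ ∂²/∂xᵢ²)ᵐ w`. -/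
def qCurvature (m : ℕ) (w : RSpace (2 * m) → ℝ) (x : RSpace (2 * m)) : ℝ :=
  Real.exp (-((2 * m : ℕ) : ℝ) * w x) * (posLaplacian^[m] w) x

/-- The volume `|S^{n-1}|` of the unit sphere of `ℝⁿ`. -/
def unitSphereVolume (n : ℕ) : ℝ :=
  (volume : Measure (RSpace n)).toSphere.real Set.univ

/-- The constant `Cₙ = 1 / (((n-2)!!)² |S^{n-1}|)`, used for even `n ≥ 2` only. -/
def gaussBonnetConst (n : ℕ) : ℝ :=
  1 / (((Nat.doubleFactorial (n - 2) : ℕ) : ℝ) ^ 2 * unitSphereVolume n)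

end

/-! ### Linear differential equations and inequalities on a half-line. -/

section Asymptotics

open Polynomial

/-! In the variable `t = log r` a radial `w` becomes a function `V t`, and with `D = d/dt` the
operator `r ^ n * (-Δ) ^ m` becomes, for `n = 2m = 2(N + 1)`, `-D ∏ (2i + D)(2i - D) D`, with `i`
from `1` to `N` (`neg_one_pow_mul_radialSymbol`). It is a total derivative, so `∫ Q dv` is
`-|S^{n-1}|` times the change of `G = ∏ (2i + D)(2i - D) V'` between `t = -∞` and `t = ∞`.
Smoothness of `w` at the origin makes `G` vanish at `-∞`. Integrability of `Q` makes `G` converge to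
some `L` at `∞` (`exists_tendsto_and_integral_qCurvature`).

The two geometric hypotheses then control `V'`. Nonnegative scalar curvature near infinity is a
Riccati inequality that bounds `V'` when `N > 0` (`exists_eventually_abs_le_of_riccati`). This
excludes the growing homogeneous solutions `e^{2it}`, so `V'` converges to `L / ((2N)!!)²`
(`tendsto_of_tendsto_shiftProd_mul_reflProd`). Completeness forces this limit to be at least `-1`:
otherwise a radial ray has finite length (`neg_one_le_of_isCompleteMetric`). Hence `-L ≤
((n-2)!!)²`, which is the claim. -/

/-- The smooth functions on the real line. -/
def smoothFunctions : Submodule ℝ (ℝ → ℝ) where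
  carrier := {f | ContDiff ℝ ∞ f}
  add_mem' {f g} (hf : ContDiff ℝ ∞ f) (hg : ContDiff ℝ ∞ g) := hf.add hg
  zero_mem' := (contDiff_const : ContDiff ℝ ∞ fun _ : ℝ => (0 : ℝ))
  smul_mem' c f (hf : ContDiff ℝ ∞ f) := hf.const_smul c

theorem smoothFunctions_contDiff (f : smoothFunctions) : ContDiff ℝ ∞ f.1 := f.2

theorem smoothFunctions_differentiable (f : smoothFunctions) : Differentiable ℝ f.1 :=
  (smoothFunctions_contDiff f).differentiable (by simp)

/-- Differentiation as an endomorphism of the space of smooth functions. -/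
noncomputable def smoothDeriv : smoothFunctions →ₗ[ℝ] smoothFunctions where
  toFun f := ⟨deriv f.1, ContDiff.deriv' (n := ∞) (smoothFunctions_contDiff f)⟩
  map_add' f g := by
    ext t
    exact deriv_add (smoothFunctions_differentiable f t) (smoothFunctions_differentiable g t)
  map_smul' c f := by
    ext t
    exact deriv_const_smul c (smoothFunctions_differentiable f t)

theorem smoothFunctions_hasDerivAt (f : smoothFunctions) (t : ℝ) :
    HasDerivAt f.1 ((smoothDeriv f).1 t) t :=
  (smoothFunctions_differentiable f t).hasDerivAt

/-- A bound on the limit superior of solutions of `k' + a k ≤ b`. -/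
theorem eventually_le_of_deriv_add_mul_le {k k' : ℝ → ℝ} {a b : ℝ} (ha : 0 < a)
    (hk : ∀ t, HasDerivAt k (k' t) t) (h : ∀ᶠ t in atTop, k' t + a * k t ≤ a * b)
    {ε : ℝ} (hε : 0 < ε) : ∀ᶠ t in atTop, k t < b + ε := by
  obtain ⟨T, hT⟩ := eventually_atTop.1 h
  -- Integrating factor `e^{at}`.
  have hd : ∀ t, HasDerivAt (fun t => Real.exp (a * t) * (k t - b))
      (Real.exp (a * t) * (k' t + a * k t - a * b)) t := fun t => by
    have h1 : HasDerivAt (fun t => Real.exp (a * t)) (Real.exp (a * t) * a) t := by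
      simpa using ((hasDerivAt_id t).const_mul a).exp
    exact (h1.mul ((hk t).sub_const b)).congr_deriv (by ring)
  have hanti : AntitoneOn (fun t => Real.exp (a * t) * (k t - b)) (Set.Ici T) := by
    refine antitoneOn_of_hasDerivWithinAt_nonpos (convex_Ici T)
      (fun t _ => (hd t).continuousAt.continuousWithinAt) (fun t _ => (hd t).hasDerivWithinAt) ?_
    intro t ht
    rw [interior_Ici] at ht
    exact mul_nonpos_of_nonneg_of_nonpos (Real.exp_pos _).le (by linarith [hT t (le_of_lt ht)])
  set C := Real.exp (a * T) * (k T - b)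
  have hlim : Tendsto (fun t => C * Real.exp (-(a * t))) atTop (𝓝 0) := by
    have := (Real.tendsto_exp_neg_atTop_nhds_zero.comp
      (tendsto_id.const_mul_atTop ha)).const_mul C
    simpa [Function.comp_def] using this
  filter_upwards [hlim.eventually_lt_const hε, eventually_ge_atTop T] with t h1 h2
  have h3 : Real.exp (a * t) * (k t - b) ≤ C := hanti (Set.mem_Ici.2 le_rfl) h2 h2
  have h4 : k t - b ≤ C * Real.exp (-(a * t)) := by
    rw [Real.exp_neg, ← div_eq_mul_inv, le_div_iff₀ (Real.exp_pos _)]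
    linarith
  linarith

/-- If `k' + a k` converges and `a > 0` then `k` converges. -/
theorem tendsto_of_tendsto_deriv_add_mul {k k' : ℝ → ℝ} {a L : ℝ} (ha : 0 < a)
    (hk : ∀ t, HasDerivAt k (k' t) t) (h : Tendsto (fun t => k' t + a * k t) atTop (𝓝 L)) :
    Tendsto k atTop (𝓝 (L / a)) := by
  refine tendsto_order.2 ⟨fun c hc => ?_, fun c hc => ?_⟩
  · have hc' : 0 < (L / a - c) / 2 := by linarith
    have h1 : ∀ᶠ t in atTop, -k' t + a * -k t ≤ a * (-(L / a) + (L / a - c) / 2) := by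
      have : a * (L / a - (L / a - c) / 2) < L := by
        have : a * (L / a) = L := mul_div_cancel₀ _ ha.ne'
        nlinarith [mul_pos ha hc']
      filter_upwards [h.eventually_const_lt this] with t ht
      linarith
    filter_upwards [eventually_le_of_deriv_add_mul_le ha (fun t => (hk t).neg) h1 hc'] with t ht
    linarith [show -k t < -(L / a) + (L / a - c) / 2 + (L / a - c) / 2 from ht]
  · have hc' : 0 < (c - L / a) / 2 := by linarith
    have h1 : ∀ᶠ t in atTop, k' t + a * k t ≤ a * (L / a + (c - L / a) / 2) := by
      have : L < a * (L / a + (c - L / a) / 2) := by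
        have : a * (L / a) = L := mul_div_cancel₀ _ ha.ne'
        nlinarith [mul_pos ha hc']
      filter_upwards [h.eventually_lt_const this] with t ht
      linarith
    filter_upwards [eventually_le_of_deriv_add_mul_le ha hk h1 hc'] with t ht
    linarith

theorem hasDerivAt_exp_neg_mul (a t : ℝ) :
    HasDerivAt (fun t => Real.exp (-(a * t))) (-(a * Real.exp (-(a * t)))) t := by
  have := (((hasDerivAt_id t).const_mul a).neg).exp
  exact this.congr_deriv (by simp [mul_comm])

theorem tendsto_exp_neg_mul {a : ℝ} (ha : 0 < a) :
    Tendsto (fun t => Real.exp (-(a * t))) atTop (𝓝 0) :=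
  Real.tendsto_exp_neg_atTop_nhds_zero.comp (tendsto_id.const_mul_atTop ha)

theorem hasDerivAt_exp_neg_mul_mul {k : ℝ → ℝ} {k' : ℝ} (a : ℝ) {t : ℝ}
    (hk : HasDerivAt k k' t) :
    HasDerivAt (fun t => Real.exp (-(a * t)) * k t) (-(Real.exp (-(a * t)) * (a * k t - k'))) t :=
  ((hasDerivAt_exp_neg_mul a t).mul hk).congr_deriv (by ring)

/-- If `a k - k'` converges, `a > 0`, and `k = o(e^{at})`, then `k` converges. -/
theorem tendsto_of_tendsto_mul_sub_deriv {k k' : ℝ → ℝ} {a L : ℝ} (ha : 0 < a)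
    (hk : ∀ t, HasDerivAt k (k' t) t) (h : Tendsto (fun t => a * k t - k' t) atTop (𝓝 L))
    (h0 : Tendsto (fun t => Real.exp (-(a * t)) * k t) atTop (𝓝 0)) :
    Tendsto k atTop (𝓝 (L / a)) := by
  -- L'Hôpital for `k = (e^{-at} k) / e^{-at}`: numerator and denominator both vanish at infinity,
  -- and the quotient of the derivatives is `(a k - k') / a`.
  have key := HasDerivAt.lhopital_zero_atTop (l := 𝓝 (L / a))
    (Eventually.of_forall fun t => hasDerivAt_exp_neg_mul_mul a (hk t))
    (Eventually.of_forall fun t => hasDerivAt_exp_neg_mul a t)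
    (Eventually.of_forall fun t => by
      have := Real.exp_pos (-(a * t))
      simp [ha.ne'])
    h0 (tendsto_exp_neg_mul ha) ?_
  · refine key.congr fun t => ?_
    have := (Real.exp_pos (-(a * t))).ne'
    field_simp
  · refine (h.div_const a).congr fun t => ?_
    have := (Real.exp_pos (-(a * t))).ne'
    field_simp

/-- If `a k - k'` converges and `a > 0`, then `e^{-at} k` converges. -/
theorem exists_tendsto_exp_mul_of_tendsto_mul_sub_deriv {k k' : ℝ → ℝ} {a L : ℝ} (ha : 0 < a)
    (hk : ∀ t, HasDerivAt k (k' t) t) (hk' : Continuous k')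
    (h : Tendsto (fun t => a * k t - k' t) atTop (𝓝 L)) :
    ∃ c, Tendsto (fun t => Real.exp (-(a * t)) * k t) atTop (𝓝 c) := by
  -- The derivative of `e^{-at} k` is `e^{-at}` times a function that converges, hence integrable.
  refine ⟨_, tendsto_limUnder_of_hasDerivAt_of_integrableOn_Ioi (a := 0)
    (fun t _ => hasDerivAt_exp_neg_mul_mul a (hk t)) (Integrable.neg ?_)⟩
  have hkc : Continuous k := continuous_iff_continuousAt.2 fun t => (hk t).continuousAt
  refine integrable_of_isBigO_exp_neg (b := a) ha (by fun_prop) ?_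
  have := (Asymptotics.isBigO_refl (fun t => Real.exp (-a * t)) atTop).mul (h.isBigO_one ℝ)
  simpa [neg_mul] using this

/-- The polynomial `∏_{1 ≤ i ≤ N} (X + 2i)`. -/
noncomputable def shiftProd (N : ℕ) : ℝ[X] := ∏ i ∈ Finset.range N, (X + C (2 * ((i : ℝ) + 1)))

/-- The polynomial `∏_{1 ≤ i ≤ N} (2i - X)`. -/
noncomputable def reflProd (N : ℕ) : ℝ[X] := ∏ i ∈ Finset.range N, (C (2 * ((i : ℝ) + 1)) - X)

/-- The number `∏_{1 ≤ i ≤ N} 2i`. -/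
def evenProd (N : ℕ) : ℝ := ∏ i ∈ Finset.range N, (2 * ((i : ℝ) + 1))

theorem evenProd_pos (N : ℕ) : 0 < evenProd N :=
  Finset.prod_pos fun i _ => by positivity

theorem evenProd_eq_doubleFactorial (N : ℕ) : evenProd N = ((2 * N).doubleFactorial : ℕ) := by
  induction N with
  | zero => simp [evenProd]
  | succ N ih =>
    rw [evenProd, Finset.prod_range_succ, ← evenProd, ih,
      show 2 * (N + 1) = 2 * N + 2 by ring, Nat.doubleFactorial_add_two]
    push_cast
    ring

theorem aeval_X_add_C_apply (a : ℝ) (k : smoothFunctions) (t : ℝ) :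
    (aeval smoothDeriv (X + C a) k).1 t = (smoothDeriv k).1 t + a * k.1 t := by
  simp [Algebra.algebraMap_eq_smul_one]

theorem aeval_C_sub_X_apply (a : ℝ) (k : smoothFunctions) (t : ℝ) :
    (aeval smoothDeriv (C a - X) k).1 t = a * k.1 t - (smoothDeriv k).1 t := by
  simp [Algebra.algebraMap_eq_smul_one]

/-- The homogeneous solutions `e^{-2it}` all decay, so the factors can be inverted one by one with
no growth condition on `k`. -/
theorem tendsto_of_tendsto_shiftProd (N : ℕ) (k : smoothFunctions) {L : ℝ}
    (h : Tendsto (aeval smoothDeriv (shiftProd N) k).1 atTop (𝓝 L)) :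
    Tendsto k.1 atTop (𝓝 (L / evenProd N)) := by
  induction N generalizing L with
  | zero => simpa [shiftProd, evenProd] using h
  | succ N ih =>
    rw [shiftProd, Finset.prod_range_succ, mul_comm, map_mul, Module.End.mul_apply,
      ← shiftProd] at h
    have h1 := tendsto_of_tendsto_deriv_add_mul (a := 2 * ((N : ℝ) + 1)) (by positivity)
      (smoothFunctions_hasDerivAt (aeval smoothDeriv (shiftProd N) k))
      (h.congr fun t => aeval_X_add_C_apply _ _ t)
    have h2 := ih h1
    rwa [div_div, mul_comm, evenProd, ← Finset.prod_range_succ, ← evenProd] at h2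

/-- If `e^{-at} (∏ (2i - D)) k → c` with `a` larger than all `2i`, then `e^{-at} k` converges,
and its limit vanishes only if `c` does. -/
theorem exists_tendsto_exp_mul_of_reflProd (N : ℕ) (k : smoothFunctions) {a c : ℝ}
    (ha : 2 * (N : ℝ) < a)
    (h : Tendsto (fun t => Real.exp (-(a * t)) * (aeval smoothDeriv (reflProd N) k).1 t)
      atTop (𝓝 c)) :
    ∃ d, Tendsto (fun t => Real.exp (-(a * t)) * k.1 t) atTop (𝓝 d) ∧ (d = 0 → c = 0) := by
  induction N generalizing c with
  | zero => exact ⟨c, by simpa [reflProd] using h, id⟩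
  | succ N ih =>
    rw [reflProd, Finset.prod_range_succ, mul_comm, map_mul, Module.End.mul_apply,
      ← reflProd] at h
    push_cast at ha
    set y := aeval smoothDeriv (reflProd N) k
    have hpos : 0 < a - 2 * ((N : ℝ) + 1) := by linarith
    -- With `b = 2(N + 1)`, the function `z = e^{-at} y` satisfies `z' + (a - b) z = -e^{-at} (b y -
    -- y')`, so its limit is a nonzero multiple of `c`.
    have h1 := tendsto_of_tendsto_deriv_add_mul (L := -c) hpos
      (fun t => hasDerivAt_exp_neg_mul_mul a (smoothFunctions_hasDerivAt y t))
      (h.neg.congr fun t => by rw [aeval_C_sub_X_apply]; ring)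
    obtain ⟨d, hd, hd0⟩ := ih (by linarith) h1
    refine ⟨d, hd, fun h0 => ?_⟩
    have := hd0 h0
    rw [div_eq_zero_iff] at this
    rcases this with h | h <;> linarith

/-- Each factor `2i - D` has the growing solution `e^{2it}`, which must be excluded before the
factor is inverted. The largest exponent is removed first, since its coefficient is then visible in
the growth of `k` itself. -/
theorem tendsto_of_tendsto_reflProd (N : ℕ) (k : smoothFunctions) {L : ℝ}
    (hk : ∀ i < N, Tendsto (fun t => Real.exp (-(2 * ((i : ℝ) + 1) * t)) * k.1 t) atTop (𝓝 0))
    (h : Tendsto (aeval smoothDeriv (reflProd N) k).1 atTop (𝓝 L)) :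
    Tendsto k.1 atTop (𝓝 (L / evenProd N)) := by
  induction N generalizing L with
  | zero => simpa [reflProd, evenProd] using h
  | succ N ih =>
    rw [reflProd, Finset.prod_range_succ, mul_comm, map_mul, Module.End.mul_apply,
      ← reflProd] at h
    set y := aeval smoothDeriv (reflProd N) k with hy
    have hpos : 0 < 2 * ((N : ℝ) + 1) := by positivity
    have h' := h.congr fun t => aeval_C_sub_X_apply _ _ t
    obtain ⟨c, hc⟩ := exists_tendsto_exp_mul_of_tendsto_mul_sub_deriv hpos
      (smoothFunctions_hasDerivAt y) (smoothFunctions_differentiable (smoothDeriv y)).continuous h'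
    obtain ⟨d, hd, hd0⟩ := exists_tendsto_exp_mul_of_reflProd N k
      (a := 2 * ((N : ℝ) + 1)) (by linarith) hc
    -- The growth hypothesis at the top exponent gives `d = 0`, hence `c = 0`: `y` has no
    -- `e^{2(N+1)t}` component.
    rw [hd0 (tendsto_nhds_unique hd (hk N N.lt_succ_self))] at hc
    have h1 := tendsto_of_tendsto_mul_sub_deriv hpos (smoothFunctions_hasDerivAt y) h' hc
    have h2 := ih (fun i hi => hk i (hi.trans N.lt_succ_self)) h1
    rwa [div_div, mul_comm, evenProd, ← Finset.prod_range_succ, ← evenProd] at h2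

/-- A solution `h` of `∏ (2i + D)(2i - D) h = G` that grows more slowly than `e^{2t}` converges
when `G` does. -/
theorem tendsto_of_tendsto_shiftProd_mul_reflProd (N : ℕ) (k : smoothFunctions) {L : ℝ}
    (hk : ∀ i < N, Tendsto (fun t => Real.exp (-(2 * ((i : ℝ) + 1) * t)) * k.1 t) atTop (𝓝 0))
    (h : Tendsto (aeval smoothDeriv (shiftProd N * reflProd N) k).1 atTop (𝓝 L)) :
    Tendsto k.1 atTop (𝓝 (L / evenProd N ^ 2)) := by
  rw [map_mul, Module.End.mul_apply] at h
  rw [sq, ← div_div]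
  exact tendsto_of_tendsto_reflProd N k hk (tendsto_of_tendsto_shiftProd N _ h)

/-- The differential inequality that expresses nonnegative scalar curvature of a rotationally
symmetric conformal metric near infinity bounds the logarithmic derivative. -/
theorem exists_eventually_abs_le_of_riccati {V h h' : ℝ → ℝ} {a : ℝ} (ha : 0 < a)
    (hV : ∀ t, HasDerivAt V (h t) t) (hh : ∀ t, HasDerivAt h (h' t) t)
    (hR : ∀ᶠ t in atTop, h' t + 2 * a * h t + a * h t ^ 2 ≤ 0) :
    ∃ C, ∀ᶠ t in atTop, |h t| ≤ C := by
  obtain ⟨T, hT⟩ := eventually_atTop.1 hR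
  -- The integrating factor `s = e^{aV + 2at}` turns the Riccati expression into the exact
  -- derivative `(s h)' = s (h' + 2ah + ah²)`.
  obtain ⟨s, hs, hspos⟩ : ∃ s : ℝ → ℝ, (∀ t, HasDerivAt s (s t * (a * h t + 2 * a)) t) ∧
      ∀ t, 0 < s t := by
    refine ⟨fun t => Real.exp (a * V t + 2 * a * t), fun t => ?_, fun t => Real.exp_pos _⟩
    have := (((hV t).const_mul a).add ((hasDerivAt_id t).const_mul (2 * a))).exp
    exact this.congr_deriv (by simp)
  have hq : ∀ t, HasDerivAt (fun t => s t * h t)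
      (s t * (h' t + 2 * a * h t + a * h t ^ 2)) t := fun t =>
    ((hs t).mul (hh t)).congr_deriv (by ring)
  have hqanti : AntitoneOn (fun t => s t * h t) (Set.Ici T) := by
    refine antitoneOn_of_hasDerivWithinAt_nonpos (convex_Ici T)
      (fun t _ => (hq t).continuousAt.continuousWithinAt) (fun t _ => (hq t).hasDerivWithinAt) ?_
    intro t ht
    rw [interior_Ici] at ht
    exact mul_nonpos_of_nonneg_of_nonpos (hspos t).le (hT t (le_of_lt ht))
  -- The quantity `z = e^{-2at} s'` is antitone, and it would tend `s` to `-∞` if negative.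
  have hz : ∀ t, HasDerivAt (fun t => Real.exp (-(2 * a * t)) * (s t * (a * h t + 2 * a)))
      (Real.exp (-(2 * a * t)) * (a * (s t * (h' t + 2 * a * h t + a * h t ^ 2)))) t := fun t => by
    have := hasDerivAt_exp_neg_mul_mul (2 * a)
      ((hs t).mul (((hh t).const_mul a).add_const (2 * a)))
    exact this.congr_deriv (by simp only [Pi.mul_apply]; ring)
  have hzanti : AntitoneOn (fun t => Real.exp (-(2 * a * t)) * (s t * (a * h t + 2 * a)))
      (Set.Ici T) := by
    refine antitoneOn_of_hasDerivWithinAt_nonpos (convex_Ici T)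
      (fun t _ => (hz t).continuousAt.continuousWithinAt) (fun t _ => (hz t).hasDerivWithinAt) ?_
    intro t ht
    rw [interior_Ici] at ht
    refine mul_nonpos_of_nonneg_of_nonpos (Real.exp_pos _).le ?_
    exact mul_nonpos_of_nonneg_of_nonpos ha.le
      (mul_nonpos_of_nonneg_of_nonpos (hspos t).le (hT t (le_of_lt ht)))
  have hlow : ∀ t ≥ T, -2 ≤ h t := by
    intro t₀ ht₀
    by_contra! hlt
    set d := s t₀ * (a * h t₀ + 2 * a) with hd
    have hdneg : d < 0 := mul_neg_of_pos_of_neg (hspos _) (by nlinarith)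
    have hder : ∀ t ≥ t₀, s t * (a * h t + 2 * a) ≤ d := by
      intro t ht
      have h1 : Real.exp (-(2 * a * t)) * (s t * (a * h t + 2 * a)) ≤
          Real.exp (-(2 * a * t₀)) * d :=
        hzanti (Set.mem_Ici.2 ht₀) (Set.mem_Ici.2 (ht₀.le.trans ht)) ht
      have h2 : Real.exp (-(2 * a * t)) ≤ Real.exp (-(2 * a * t₀)) :=
        Real.exp_le_exp.2 (by nlinarith)
      have h3 : Real.exp (-(2 * a * t)) * (s t * (a * h t + 2 * a)) ≤
          Real.exp (-(2 * a * t)) * d := h1.trans (mul_le_mul_of_nonpos_right h2 hdneg.le)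
      exact le_of_mul_le_mul_left h3 (Real.exp_pos _)
    have hanti : AntitoneOn (fun t => s t - d * t) (Set.Ici t₀) := by
      have hd' : ∀ t, HasDerivAt (fun t => s t - d * t) (s t * (a * h t + 2 * a) - d) t :=
        fun t => ((hs t).sub ((hasDerivAt_id t).const_mul d)).congr_deriv (by simp)
      refine antitoneOn_of_hasDerivWithinAt_nonpos (convex_Ici t₀)
        (fun t _ => (hd' t).continuousAt.continuousWithinAt)
        (fun t _ => (hd' t).hasDerivWithinAt) ?_
      intro t ht
      rw [interior_Ici] at ht
      linarith [hder t (le_of_lt ht)]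
    -- At time `t₀ + s t₀ / -d` the line of slope `d` that bounds `s` from above reaches zero,
    -- against `s > 0`.
    have hpos : 0 ≤ s t₀ / -d := div_nonneg (hspos _).le (by linarith)
    have h1 : s (t₀ + s t₀ / -d) - d * (t₀ + s t₀ / -d) ≤ s t₀ - d * t₀ :=
      hanti (Set.mem_Ici.2 le_rfl) (Set.mem_Ici.2 (by linarith)) (by linarith)
    have h2 : d * (s t₀ / -d) = -s t₀ := by
      have := hdneg.ne
      field_simp
    have := hspos (t₀ + s t₀ / -d)
    nlinarith
  have hsmono : MonotoneOn s (Set.Ici T) := by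
    refine monotoneOn_of_hasDerivWithinAt_nonneg (convex_Ici T)
      (fun t _ => (hs t).continuousAt.continuousWithinAt) (fun t _ => (hs t).hasDerivWithinAt) ?_
    intro t ht
    rw [interior_Ici] at ht
    exact mul_nonneg (hspos t).le (by nlinarith [hlow t (le_of_lt ht)])
  -- The `2` serves the lower bound `-2 ≤ h` and also makes the constant nonnegative, so that `s T ≤
  -- s t` can be multiplied by it.
  refine ⟨max 2 (h T), eventually_atTop.2 ⟨T, fun t ht => abs_le.2 ⟨?_, ?_⟩⟩⟩
  · linarith [hlow t ht, le_max_left 2 (h T)]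
  · have h1 : s t * h t ≤ s T * h T := hqanti (Set.mem_Ici.2 le_rfl) (Set.mem_Ici.2 ht) ht
    have h2 : s T ≤ s t := hsmono (Set.mem_Ici.2 le_rfl) (Set.mem_Ici.2 ht) ht
    refine le_of_mul_le_mul_left ?_ (hspos t)
    calc s t * h t ≤ s T * h T := h1
      _ ≤ s T * max 2 (h T) := mul_le_mul_of_nonneg_left (le_max_right _ _) (hspos T).le
      _ ≤ s t * max 2 (h T) :=
        mul_le_mul_of_nonneg_right h2 (by positivity)

end Asymptotics

/-! ### The Laplacian and its powers on radial functions, in the variable `log r`. -/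

section Radial

open Polynomial

theorem laplacian_eq_sum_partialDeriv {n : ℕ} {f : RSpace n → ℝ} {x : RSpace n}
    (hf : ContDiffAt ℝ 2 f x) :
    Laplacian.laplacian f x = ∑ i, partialDeriv i (partialDeriv i f) x := by
  have hd : DifferentiableAt ℝ (fderiv ℝ f) x :=
    (hf.fderiv_right (m := 1) (by norm_num)).differentiableAt (by simp)
  rw [InnerProductSpace.laplacian_eq_iteratedFDeriv_orthonormalBasis f
    (EuclideanSpace.basisFun (Fin n) ℝ)]
  refine Finset.sum_congr rfl fun i _ => ?_
  rw [iteratedFDeriv_two_apply]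
  simp only [EuclideanSpace.basisFun_apply]
  change _ = fderiv ℝ (fun y => fderiv ℝ f y (EuclideanSpace.single i 1)) x _
  rw [fderiv_clm_apply hd (differentiableAt_const _)]
  simp

theorem partialDeriv_congr {n : ℕ} {f g : RSpace n → ℝ} {x : RSpace n} (h : f =ᶠ[𝓝 x] g)
    (i : Fin n) : partialDeriv i f x = partialDeriv i g x := by
  rw [partialDeriv, partialDeriv, h.fderiv_eq]

theorem hasFDerivAt_comp_log_norm {n : ℕ} {U : ℝ → ℝ} {U' : ℝ} {x : RSpace n} (hx : x ≠ 0)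
    (hU : HasDerivAt U U' (Real.log ‖x‖)) :
    HasFDerivAt (fun y : RSpace n => U (Real.log ‖y‖))
      ((U' * Real.exp (-(2 * Real.log ‖x‖))) • innerSL ℝ x) x := by
  have hpos : 0 < ‖x‖ := norm_pos_iff.2 hx
  have h1 : HasFDerivAt (fun y : RSpace n => ‖y‖ ^ 2) (2 • innerSL ℝ x) x :=
    (hasStrictFDerivAt_norm_sq x).hasFDerivAt
  have h2 : HasFDerivAt (fun y : RSpace n => Real.log ‖y‖)
      ((Real.exp (-(2 * Real.log ‖x‖))) • innerSL ℝ x) x := by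
    have h3 := (h1.log (by positivity)).const_mul (1 / 2)
    refine (h3.congr_fderiv ?_).congr_of_eventuallyEq (Eventually.of_forall fun y => ?_)
    · have : Real.exp (-(2 * Real.log ‖x‖)) = (‖x‖ ^ 2)⁻¹ := by
        rw [Real.exp_neg, two_mul, Real.exp_add, Real.exp_log hpos, sq]
      rw [this]
      ext v
      simp
      ring
    · simp [Real.log_pow]
  exact (hU.comp_hasFDerivAt x h2).congr_fderiv (by rw [smul_smul])

theorem partialDeriv_comp_log_norm {n : ℕ} {f : RSpace n → ℝ} {U : ℝ → ℝ} {U' : ℝ}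
    {x : RSpace n} (hx : x ≠ 0) (hf : f =ᶠ[𝓝 x] fun y => U (Real.log ‖y‖))
    (hU : HasDerivAt U U' (Real.log ‖x‖)) (i : Fin n) :
    partialDeriv i f x = x i * (Real.exp (-(2 * Real.log ‖x‖)) * U') := by
  rw [partialDeriv_congr hf, partialDeriv, (hasFDerivAt_comp_log_norm hx hU).fderiv]
  simp [EuclideanSpace.inner_single_right]
  ring

theorem sum_sq_eq_exp_log_norm {n : ℕ} {x : RSpace n} (hx : x ≠ 0) :
    ∑ i, x i ^ 2 = Real.exp (2 * Real.log ‖x‖) := by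
  rw [two_mul, Real.exp_add, Real.exp_log (norm_pos_iff.2 hx), ← sq,
    EuclideanSpace.real_norm_sq_eq]

theorem partialDeriv_partialDeriv_comp_log_norm {n : ℕ} {f : RSpace n → ℝ} {U : smoothFunctions}
    {x : RSpace n} (hx : x ≠ 0) (hf : f =ᶠ[𝓝 x] fun y => U.1 (Real.log ‖y‖)) (i : Fin n) :
    partialDeriv i (partialDeriv i f) x =
      Real.exp (-(2 * Real.log ‖x‖)) * (smoothDeriv U).1 (Real.log ‖x‖) +
      x i ^ 2 * (Real.exp (-(2 * Real.log ‖x‖)) * (Real.exp (-(2 * Real.log ‖x‖)) *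
        ((smoothDeriv (smoothDeriv U)).1 (Real.log ‖x‖) -
          2 * (smoothDeriv U).1 (Real.log ‖x‖)))) := by
  have h1 : partialDeriv i f =ᶠ[𝓝 x] fun y => y i *
      (Real.exp (-(2 * Real.log ‖y‖)) * (smoothDeriv U).1 (Real.log ‖y‖)) := by
    filter_upwards [hf.eventually_nhds, isOpen_ne.mem_nhds hx] with y hy hy0
    exact partialDeriv_comp_log_norm hy0 hy (smoothFunctions_hasDerivAt U _) i
  have h2 := hasFDerivAt_comp_log_norm hx (hasDerivAt_exp_neg_mul_mul 2
    (smoothFunctions_hasDerivAt (smoothDeriv U) (Real.log ‖x‖)))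
  have h3 : HasFDerivAt (fun y : RSpace n => y i) (EuclideanSpace.proj i : RSpace n →L[ℝ] ℝ) x :=
    (EuclideanSpace.proj i : RSpace n →L[ℝ] ℝ).hasFDerivAt
  rw [partialDeriv_congr h1, partialDeriv, (h3.fun_mul h2).fderiv]
  simp [EuclideanSpace.inner_single_right]
  ring

theorem sum_partialDeriv_comp_log_norm {n : ℕ} {f : RSpace n → ℝ} {U : smoothFunctions}
    {x : RSpace n} (hx : x ≠ 0) (hf : f =ᶠ[𝓝 x] fun y => U.1 (Real.log ‖y‖)) :
    ∑ i, partialDeriv i (partialDeriv i f) x = Real.exp (-(2 * Real.log ‖x‖)) *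
      ((smoothDeriv (smoothDeriv U)).1 (Real.log ‖x‖) +
        ((n : ℝ) - 2) * (smoothDeriv U).1 (Real.log ‖x‖)) := by
  simp_rw [partialDeriv_partialDeriv_comp_log_norm hx hf]
  rw [Finset.sum_add_distrib, ← Finset.sum_mul, ← Finset.sum_mul,
    sum_sq_eq_exp_log_norm hx, ← mul_assoc, ← Real.exp_add]
  simp
  ring

theorem contDiffAt_comp_log_norm {n : ℕ} (U : smoothFunctions) {x : RSpace n} (hx : x ≠ 0) :
    ContDiffAt ℝ ∞ (fun y : RSpace n => U.1 (Real.log ‖y‖)) x :=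
  (smoothFunctions_contDiff U).contDiffAt.comp x
    ((contDiffAt_norm ℝ hx).log (norm_ne_zero_iff.2 hx))

theorem laplacian_comp_log_norm {n : ℕ} {f : RSpace n → ℝ} {U : smoothFunctions}
    {x : RSpace n} (hx : x ≠ 0) (hf : f =ᶠ[𝓝 x] fun y => U.1 (Real.log ‖y‖)) :
    Laplacian.laplacian f x = Real.exp (-(2 * Real.log ‖x‖)) *
      ((smoothDeriv (smoothDeriv U)).1 (Real.log ‖x‖) +
        ((n : ℝ) - 2) * (smoothDeriv U).1 (Real.log ‖x‖)) := by
  rw [laplacian_eq_sum_partialDeriv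
    (((contDiffAt_comp_log_norm U hx).congr_of_eventuallyEq hf).of_le (by norm_cast)),
    sum_partialDeriv_comp_log_norm hx hf]

/-- The symbol of `r^{2j} Δ^j` on radial functions of `ℝⁿ`, in the variable `log r`. -/
noncomputable def radialSymbol (n : ℝ) (j : ℕ) : ℝ[X] :=
  ∏ i ∈ Finset.range j, ((X - C (2 * (i : ℝ))) * (X + C (n - 2 - 2 * (i : ℝ))))

/-- The function `e^{-at} U`. -/
noncomputable def expMulSmooth (a : ℝ) (U : smoothFunctions) : smoothFunctions :=
  ⟨fun t => Real.exp (-(a * t)) * U.1 t, by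
    have := smoothFunctions_contDiff U
    change ContDiff ℝ ∞ fun t => Real.exp (-(a * t)) * U.1 t
    fun_prop⟩

theorem smoothDeriv_expMulSmooth (a : ℝ) (U : smoothFunctions) :
    smoothDeriv (expMulSmooth a U) = expMulSmooth a (smoothDeriv U - a • U) := by
  ext t
  refine ((smoothFunctions_hasDerivAt (expMulSmooth a U) t).unique
    (hasDerivAt_exp_neg_mul_mul a (smoothFunctions_hasDerivAt U t))).trans ?_
  simp [expMulSmooth]
  ring

/-- On radial functions `r² Δ = D (D + n - 2)`. Moving it past the factor `e^{-2jt}` left by the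
first `j` steps replaces `D` by `D - 2j`, which yields the next pair of factors of `radialSymbol`.
-/
theorem iterate_posLaplacian_comp_log_norm {n : ℕ} {w : RSpace n → ℝ} {V : smoothFunctions}
    (hw : ∀ x ≠ 0, w x = V.1 (Real.log ‖x‖)) (j : ℕ) :
    ∀ x ≠ 0, (posLaplacian^[j] w) x = Real.exp (-(2 * (j : ℝ) * Real.log ‖x‖)) *
      ((-1) ^ j * (aeval smoothDeriv (radialSymbol n j) V).1 (Real.log ‖x‖)) := by
  induction j with
  | zero => simpa [radialSymbol] using hw
  | succ j ih =>
    intro x hx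
    set U := aeval smoothDeriv (radialSymbol n j) V with hU
    have hf : (posLaplacian^[j] w) =ᶠ[𝓝 x] fun y =>
        (expMulSmooth (2 * j) ((-1 : ℝ) ^ j • U)).1 (Real.log ‖y‖) := by
      filter_upwards [isOpen_ne.mem_nhds hx] with y hy
      exact ih y hy
    rw [Function.iterate_succ_apply', posLaplacian, laplacian_comp_log_norm hx hf,
      smoothDeriv_expMulSmooth, smoothDeriv_expMulSmooth, radialSymbol, Finset.prod_range_succ,
      ← radialSymbol, mul_comm (radialSymbol _ _), map_mul, Module.End.mul_apply, ← hU]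
    have he : Real.exp (-(2 * ((j + 1 : ℕ) : ℝ) * Real.log ‖x‖)) =
        Real.exp (-(2 * Real.log ‖x‖)) * Real.exp (-(2 * j * Real.log ‖x‖)) := by
      rw [← Real.exp_add]
      push_cast
      ring_nf
    rw [he]
    simp [expMulSmooth, Algebra.algebraMap_eq_smul_one]
    ring

/-- In the critical dimension `n - 2 - 2i = 2(N - i)`, so reversing the second product makes the
roots symmetric about `0`. Each product contributes one factor `X`: one makes the expression a total
derivative, the other produces `V'`. -/
theorem neg_one_pow_mul_radialSymbol (N : ℕ) :
    (-1) ^ (N + 1) * radialSymbol ((2 * (N + 1) : ℕ) : ℝ) (N + 1) =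
      -(X * (shiftProd N * reflProd N * X)) := by
  have h1 : radialSymbol ((2 * (N + 1) : ℕ) : ℝ) (N + 1) =
      (∏ i ∈ Finset.range (N + 1), (X - C (2 * (i : ℝ)))) *
        ∏ i ∈ Finset.range (N + 1), (X + C (2 * (i : ℝ))) := by
    rw [radialSymbol, Finset.prod_mul_distrib]
    congr 1
    rw [← Finset.prod_range_reflect]
    refine Finset.prod_congr rfl fun i hi => ?_
    have : i ≤ N := Nat.lt_succ_iff.1 (Finset.mem_range.1 hi)
    rw [Nat.add_sub_cancel, Nat.cast_sub this]
    congr 2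
    push_cast
    ring
  have h2 : (-1) ^ N * ∏ i ∈ Finset.range N, (X - C (2 * ((i : ℝ) + 1))) = reflProd N := by
    rw [reflProd]
    have : ∀ i ∈ Finset.range N, C (2 * ((i : ℝ) + 1)) - X =
        (-1 : ℝ[X]) * (X - C (2 * ((i : ℝ) + 1))) := fun i _ => by ring
    rw [Finset.prod_congr rfl this, Finset.prod_mul_distrib]
    simp
  rw [h1, Finset.prod_range_succ', Finset.prod_range_succ', ← h2, shiftProd]
  push_cast
  simp only [mul_zero, map_zero, sub_zero, add_zero]
  ring

/-- In the variable `r = e^t`, `D` is `r d/dr`, which preserves smoothness up to and across `r = 0`.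
This supplies the behaviour at `t = -∞`. -/
theorem exists_comp_exp_of_aeval (p : ℝ[X]) {V : smoothFunctions}
    (hV : ∃ ψ : smoothFunctions, ∀ t, V.1 t = ψ.1 (Real.exp t)) :
    ∃ ψ : smoothFunctions, ∀ t, (aeval smoothDeriv p V).1 t = ψ.1 (Real.exp t) := by
  induction p using Polynomial.induction_on' with
  | add p q hp hq =>
    obtain ⟨f, hf⟩ := hp
    obtain ⟨g, hg⟩ := hq
    exact ⟨f + g, fun t => by simp [hf, hg]⟩
  | monomial k a =>
    suffices h : ∃ ψ : smoothFunctions, ∀ t, ((smoothDeriv ^ k) V).1 t = ψ.1 (Real.exp t) by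
      obtain ⟨f, hf⟩ := h
      exact ⟨a • f, fun t => by simp [aeval_monomial, Algebra.algebraMap_eq_smul_one, hf]⟩
    induction k with
    | zero => simpa using hV
    | succ k ih =>
      obtain ⟨f, hf⟩ := ih
      have hs : ContDiff ℝ ∞ fun r => (smoothDeriv f).1 r * r :=
        (smoothFunctions_contDiff _).mul contDiff_id
      refine ⟨⟨_, hs⟩, fun t => ?_⟩
      rw [pow_succ', Module.End.mul_apply]
      refine (smoothFunctions_hasDerivAt _ t).unique ?_
      exact ((smoothFunctions_hasDerivAt f (Real.exp t)).comp t (Real.hasDerivAt_exp t)).congr_of_eventuallyEq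
        (Eventually.of_forall hf)

end Radial

/-! ### The total `Q`-curvature as a boundary term. -/

section TotalCurvature

open Polynomial

theorem sqrt_det_conformalMetric {m : ℕ} (w : RSpace (2 * m) → ℝ) (x : RSpace (2 * m)) :
    Real.sqrt (conformalMetric w x).det = Real.exp (((2 * m : ℕ) : ℝ) * w x) := by
  rw [conformalMetric, Matrix.det_smul, Matrix.det_one, mul_one, Fintype.card_fin,
    ← Real.exp_nat_mul, Real.sqrt_eq_rpow, ← Real.exp_mul]
  ring_nf

theorem integrable_riemannianVolume_iff {m : ℕ} {w : RSpace (2 * m) → ℝ} (hw : Continuous w)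
    (f : RSpace (2 * m) → ℝ) :
    Integrable f (riemannianVolume (conformalMetric w)) ↔
      Integrable fun x => Real.exp (((2 * m : ℕ) : ℝ) * w x) * f x := by
  simp_rw [riemannianVolume, sqrt_det_conformalMetric]
  rw [integrable_withDensity_iff_integrable_smul' (by fun_prop) (by simp)]
  simp [ENNReal.toReal_ofReal, Real.exp_nonneg]

theorem integral_riemannianVolume {m : ℕ} {w : RSpace (2 * m) → ℝ} (hw : Continuous w)
    (f : RSpace (2 * m) → ℝ) :
    ∫ x, f x ∂(riemannianVolume (conformalMetric w)) =
      ∫ x, Real.exp (((2 * m : ℕ) : ℝ) * w x) * f x := by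
  simp_rw [riemannianVolume, sqrt_det_conformalMetric]
  rw [integral_withDensity_eq_integral_toReal_smul (by fun_prop) (by simp)]
  simp [ENNReal.toReal_ofReal, Real.exp_nonneg]

theorem exp_mul_qCurvature (m : ℕ) (w : RSpace (2 * m) → ℝ) (x : RSpace (2 * m)) :
    Real.exp (((2 * m : ℕ) : ℝ) * w x) * qCurvature m w x = (posLaplacian^[m] w) x := by
  rw [qCurvature, ← mul_assoc, ← Real.exp_add]
  simp

/-- The total `Q`-curvature of a rotationally symmetric metric is read off from the limit at
infinity of a first integral. -/
theorem exists_tendsto_and_integral_qCurvature {N : ℕ} {w : RSpace (2 * (N + 1)) → ℝ}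
    (hw : Continuous w) {φ V : smoothFunctions} (hφ : ∀ t, V.1 t = φ.1 (Real.exp t))
    (hV : ∀ x ≠ 0, w x = V.1 (Real.log ‖x‖))
    (hint : Integrable (qCurvature (N + 1) w) (riemannianVolume (conformalMetric w))) :
    ∃ L, Tendsto (aeval smoothDeriv (shiftProd N * reflProd N) (smoothDeriv V)).1 atTop (𝓝 L) ∧
      ∫ x, qCurvature (N + 1) w x ∂(riemannianVolume (conformalMetric w)) =
        -(unitSphereVolume (2 * (N + 1)) * L) := by
  set G := aeval smoothDeriv (shiftProd N * reflProd N) (smoothDeriv V) with hG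
  -- Pulling the derivative outside gives `G(log r) = r ψ'(r)`, which visibly vanishes at `r = 0`.
  have hG' : G = smoothDeriv (aeval smoothDeriv (shiftProd N * reflProd N) V) := by
    have h1 : G = aeval smoothDeriv (shiftProd N * reflProd N * X) V := by
      rw [map_mul _ _ X, Module.End.mul_apply, aeval_X]
    rw [h1, mul_comm, map_mul, Module.End.mul_apply, aeval_X]
  obtain ⟨ψ, hψ⟩ := exists_comp_exp_of_aeval (shiftProd N * reflProd N) ⟨φ, hφ⟩
  set F : ℝ → ℝ := fun r => (smoothDeriv ψ).1 r * r with hF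
  have hGF : ∀ t, G.1 t = F (Real.exp t) := fun t => by
    rw [hG']
    refine (smoothFunctions_hasDerivAt _ t).unique ?_
    exact ((smoothFunctions_hasDerivAt ψ (Real.exp t)).comp t
      (Real.hasDerivAt_exp t)).congr_of_eventuallyEq (Eventually.of_forall hψ)
  -- The radial profile `-r^{-n} G'(log r)` of `(-Δ)^m w`. Against the polar weight `r^{n-1}` it is
  -- exactly `-F'`.
  set P : ℝ → ℝ := fun r => Real.exp (-(2 * ((N + 1 : ℕ) : ℝ) * Real.log r)) *
    -(smoothDeriv G).1 (Real.log r) with hP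
  have hae : (fun x => Real.exp (((2 * (N + 1) : ℕ) : ℝ) * w x) * qCurvature (N + 1) w x)
      =ᵐ[volume] fun x => P ‖x‖ := by
    filter_upwards [(volume : Measure (RSpace (2 * (N + 1)))).ae_ne 0] with x hx
    rw [exp_mul_qCurvature, iterate_posLaplacian_comp_log_norm hV (N + 1) x hx, hP]
    congr 1
    have h1 := congrArg (fun p => (aeval smoothDeriv p V).1 (Real.log ‖x‖))
      (neg_one_pow_mul_radialSymbol N)
    have h2 : aeval smoothDeriv (-(X * (shiftProd N * reflProd N * X))) V = -smoothDeriv G := by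
      rw [hG, map_neg, map_mul, map_mul _ _ X]
      simp
    have h3 : aeval smoothDeriv ((-1) ^ (N + 1) * radialSymbol ((2 * (N + 1) : ℕ) : ℝ) (N + 1)) V
        = (-1 : ℝ) ^ (N + 1) •
          aeval smoothDeriv (radialSymbol ((2 * (N + 1) : ℕ) : ℝ) (N + 1)) V := by
      rw [show ((-1 : ℝ[X]) ^ (N + 1)) = C ((-1) ^ (N + 1)) by simp, ← smul_eq_C_mul, map_smul,
        LinearMap.smul_apply]
    simp only [h2, h3] at h1
    simpa using h1
  have hdim : Module.finrank ℝ (RSpace (2 * (N + 1))) - 1 = 2 * N + 1 := by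
    rw [finrank_euclideanSpace_fin]
    lia
  have hFd : ∀ r ∈ Set.Ioi (0 : ℝ), HasDerivAt F
      (-(r ^ (Module.finrank ℝ (RSpace (2 * (N + 1))) - 1) • P r)) r := by
    intro r (hr : 0 < r)
    have h1 := (smoothFunctions_hasDerivAt G (Real.log r)).comp r (Real.hasDerivAt_log hr.ne')
    refine (h1.congr_of_eventuallyEq ?_).congr_deriv ?_
    · filter_upwards [lt_mem_nhds hr] with s hs
      simp [hGF, Real.exp_log hs]
    · have h2 : Real.exp (-(2 * ((N + 1 : ℕ) : ℝ) * Real.log r)) = (r ^ (2 * N + 2))⁻¹ := by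
        rw [Real.exp_neg, show 2 * ((N + 1 : ℕ) : ℝ) * Real.log r =
          ((2 * N + 2 : ℕ) : ℝ) * Real.log r by push_cast; ring, Real.exp_nat_mul,
          Real.exp_log hr]
      simp only [hdim, hP, h2, smul_eq_mul]
      field_simp
      ring
  have hPint : IntegrableOn
      (fun r => r ^ (Module.finrank ℝ (RSpace (2 * (N + 1))) - 1) • P r) (Set.Ioi 0) :=
    (integrable_fun_norm_addHaar (volume : Measure (RSpace (2 * (N + 1))))).1
      (((integrable_riemannianVolume_iff hw _).1 hint).congr hae)
  have hlim := tendsto_limUnder_of_hasDerivAt_of_integrableOn_Ioi hFd hPint.neg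
  set L := limUnder atTop F
  refine ⟨L, (hlim.comp Real.tendsto_exp_atTop).congr fun t => (hGF t).symm, ?_⟩
  have hcont : Continuous F := (smoothFunctions_differentiable _).continuous.mul continuous_id
  have h1 := integral_Ioi_of_hasDerivAt_of_tendsto hcont.continuousWithinAt hFd hPint.neg hlim
  rw [integral_neg] at h1
  have h2 : F 0 = 0 := by simp [hF]
  rw [integral_riemannianVolume hw, integral_congr_ae hae, integral_fun_norm_addHaar, unitSphereVolume,
    Measure.toSphere_real_apply_univ, nsmul_eq_mul, smul_eq_mul]
  rw [h2, sub_zero] at h1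
  rw [← h1]
  ring

end TotalCurvature

/-! ### Scalar curvature of a conformally flat metric. -/

section ScalarCurvature

theorem inv_conformalMetric {n : ℕ} (w : RSpace n → ℝ) (x : RSpace n) :
    (conformalMetric w x)⁻¹ = Real.exp (-(2 * w x)) • (1 : Matrix (Fin n) (Fin n) ℝ) := by
  refine Matrix.inv_eq_left_inv ?_
  rw [conformalMetric, smul_mul_smul_comm, ← Real.exp_add]
  simp

theorem partialDeriv_conformalMetric {n : ℕ} {w : RSpace n → ℝ} {x : RSpace n}
    (hw : DifferentiableAt ℝ w x) (i j k : Fin n) :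
    partialDeriv i (fun y => conformalMetric w y j k) x =
      2 * Real.exp (2 * w x) * partialDeriv i w x * if j = k then 1 else 0 := by
  have h : HasFDerivAt (fun y => conformalMetric w y j k)
      ((if j = k then (1 : ℝ) else 0) • Real.exp (2 * w x) • (2 : ℝ) • fderiv ℝ w x) x := by
    have := ((hw.hasFDerivAt.const_mul 2).exp).const_mul (if j = k then (1 : ℝ) else 0)
    refine this.congr_of_eventuallyEq (Eventually.of_forall fun y => ?_)
    simp [conformalMetric, Matrix.one_apply]
  rw [partialDeriv, h.fderiv, partialDeriv]
  simp only [smul_smul, smul_apply, smul_eq_mul]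
  ring

theorem christoffelSymbol_conformalMetric {n : ℕ} {w : RSpace n → ℝ} {x : RSpace n}
    (hw : DifferentiableAt ℝ w x) (k i j : Fin n) :
    christoffelSymbol (conformalMetric w) k i j x =
      (if j = k then 1 else 0) * partialDeriv i w x + (if i = k then 1 else 0) * partialDeriv j w x
        - (if i = j then 1 else 0) * partialDeriv k w x := by
  simp only [christoffelSymbol, inv_conformalMetric, partialDeriv_conformalMetric hw,
    Matrix.smul_apply, Matrix.one_apply, smul_eq_mul, mul_ite, ite_mul, mul_one, mul_zero,
    zero_mul, one_mul, Finset.sum_ite_eq, Finset.mem_univ, if_true]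
  split_ifs <;> ring_nf <;> simp [← Real.exp_add]

theorem partialDeriv_christoffelSymbol {n : ℕ} {w : RSpace n → ℝ} (hw : ContDiff ℝ ∞ w)
    (l k i j : Fin n) (x : RSpace n) :
    partialDeriv l (christoffelSymbol (conformalMetric w) k i j) x =
      (if j = k then 1 else 0) * partialDeriv l (partialDeriv i w) x
        + (if i = k then 1 else 0) * partialDeriv l (partialDeriv j w) x
        - (if i = j then 1 else 0) * partialDeriv l (partialDeriv k w) x := by
  have hd : ∀ i : Fin n, DifferentiableAt ℝ (partialDeriv i w) x := fun i => by
    have h1 : ContDiff ℝ ∞ (fderiv ℝ w) := hw.fderiv_right (by simp)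
    have h2 : ContDiff ℝ ∞ (partialDeriv i w) := h1.clm_apply contDiff_const
    exact h2.differentiable (by simp) x
  have h : HasFDerivAt (christoffelSymbol (conformalMetric w) k i j)
      ((if j = k then (1 : ℝ) else 0) • fderiv ℝ (partialDeriv i w) x
        + (if i = k then (1 : ℝ) else 0) • fderiv ℝ (partialDeriv j w) x
        - (if i = j then (1 : ℝ) else 0) • fderiv ℝ (partialDeriv k w) x) x :=
    ((((hd i).hasFDerivAt.const_mul _).add ((hd j).hasFDerivAt.const_mul _)).sub
      ((hd k).hasFDerivAt.const_mul _)).congr_of_eventuallyEq (Eventually.of_forall fun y =>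
        christoffelSymbol_conformalMetric (hw.differentiable (by simp) y) k i j)
  rw [partialDeriv, h.fderiv]
  simp only [partialDeriv, add_apply, sub_apply, smul_apply, smul_eq_mul]

/-- The algebra of the trace of the Ricci tensor, with `d` and `W` standing for the first and second
partial derivatives of `w`. -/
theorem sum_conformal_ricci {n : ℕ} (d : Fin n → ℝ) (W : Fin n → Fin n → ℝ) :
    (∑ j, ((∑ i, (((if j = i then 1 else 0) * W i j + (if j = i then 1 else 0) * W i j - W i i)
        - W j j))
      + ∑ i, ∑ p, (d p * ((if j = p then 1 else 0) * d j + (if j = p then 1 else 0) * d j - d p)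
        - ((if p = i then 1 else 0) * d j + (if j = i then 1 else 0) * d p
            - (if j = p then 1 else 0) * d i)
          * ((if j = p then 1 else 0) * d i + (if i = p then 1 else 0) * d j
            - (if i = j then 1 else 0) * d p)))) =
      -(2 * ((n : ℝ) - 1) * ∑ i, W i i + ((n : ℝ) - 1) * ((n : ℝ) - 2) * ∑ i, d i ^ 2) := by
  have hprod : ∀ i j p : Fin n, ((if p = i then 1 else 0) * d j + (if j = i then 1 else 0) * d p
            - (if j = p then 1 else 0) * d i)
          * ((if j = p then 1 else 0) * d i + (if i = p then 1 else 0) * d j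
            - (if i = j then 1 else 0) * d p) =
      (if i = p then 1 else 0) * d j ^ 2 - (if j = i then 1 else 0) * d p ^ 2
        - (if j = p then 1 else 0) * d i ^ 2
        + (if j = p then 1 else 0) * ((if j = i then 1 else 0) * (2 * (d i * d p))) := by
    intro i j p
    by_cases h1 : j = p <;> by_cases h2 : j = i <;> by_cases h3 : i = p <;>
      simp_all [eq_comm] <;> ring
  have hite : ∀ (c : Prop) [Decidable c] (f : Fin n → ℝ),
      ∑ p, (if c then f p else 0) = if c then ∑ p, f p else 0 := by
    intro c _ f
    split_ifs <;> simp
  simp_rw [hprod]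
  simp only [Finset.sum_add_distrib, Finset.sum_sub_distrib, mul_sub, mul_add, ite_mul, mul_ite,
    one_mul, zero_mul, mul_zero, Finset.sum_ite_eq, Finset.mem_univ, if_true, Finset.sum_const,
    Finset.card_univ, Fintype.card_fin, nsmul_eq_mul, hite, ← Finset.mul_sum, ← sq]
  ring

theorem scalarCurvature_conformalMetric {n : ℕ} {w : RSpace n → ℝ} (hw : ContDiff ℝ ∞ w)
    (x : RSpace n) :
    scalarCurvature (conformalMetric w) x = -(Real.exp (-(2 * w x)) *
      (2 * ((n : ℝ) - 1) * ∑ i, partialDeriv i (partialDeriv i w) x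
        + ((n : ℝ) - 1) * ((n : ℝ) - 2) * ∑ i, partialDeriv i w x ^ 2)) := by
  have hd := hw.differentiable (by simp) x
  rw [← mul_neg, ← sum_conformal_ricci (fun i => partialDeriv i w x)
    (fun i j => partialDeriv i (partialDeriv j w) x), scalarCurvature, Finset.mul_sum]
  refine Finset.sum_congr rfl fun j _ => ?_
  simp only [inv_conformalMetric, Matrix.smul_apply, Matrix.one_apply, smul_eq_mul, mul_ite,
    mul_one, mul_zero, ite_mul, zero_mul, Finset.sum_ite_eq, Finset.mem_univ, if_true]
  congr 1
  simp only [ricciTensor, partialDeriv_christoffelSymbol hw,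
    christoffelSymbol_conformalMetric hd, if_true]
  congr 1
  · refine Finset.sum_congr rfl fun i _ => ?_
    by_cases h : j = i
    · subst h; simp
    · simp [h, Ne.symm h]
  · refine Finset.sum_congr rfl fun i _ => Finset.sum_congr rfl fun p _ => ?_
    by_cases h : i = p
    · subst h; simp
    · simp [h, Ne.symm h]

/-- Nonnegativity of the scalar curvature of a rotationally symmetric conformal metric as an
ordinary differential inequality in the variable `log r`. -/
theorem riccati_of_scalarCurvature_nonneg {n : ℕ} (hn : 2 ≤ n) {w : RSpace n → ℝ}
    (hw : ContDiff ℝ ∞ w) {V : smoothFunctions} (hV : ∀ x ≠ 0, w x = V.1 (Real.log ‖x‖))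
    {x : RSpace n} (hx : x ≠ 0) (h : 0 ≤ scalarCurvature (conformalMetric w) x) :
    (smoothDeriv (smoothDeriv V)).1 (Real.log ‖x‖)
      + 2 * (((n : ℝ) - 2) / 2) * (smoothDeriv V).1 (Real.log ‖x‖)
      + ((n : ℝ) - 2) / 2 * (smoothDeriv V).1 (Real.log ‖x‖) ^ 2 ≤ 0 := by
  have hf : w =ᶠ[𝓝 x] fun y => V.1 (Real.log ‖y‖) := by
    filter_upwards [isOpen_ne.mem_nhds hx] with y hy using hV y hy
  have h1 : ∑ i, partialDeriv i w x ^ 2 =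
      Real.exp (-(2 * Real.log ‖x‖)) * (smoothDeriv V).1 (Real.log ‖x‖) ^ 2 := by
    simp_rw [partialDeriv_comp_log_norm hx hf (smoothFunctions_hasDerivAt V _), mul_pow]
    rw [← Finset.sum_mul, sum_sq_eq_exp_log_norm hx, ← mul_assoc, sq (Real.exp _), ← mul_assoc,
      ← Real.exp_add]
    simp
  rw [scalarCurvature_conformalMetric hw, h1, sum_partialDeriv_comp_log_norm hx hf] at h
  have hn' : (0 : ℝ) < 2 * ((n : ℝ) - 1) := by
    have : (2 : ℝ) ≤ n := by exact_mod_cast hn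
    linarith
  have hpos : 0 < Real.exp (-(2 * w x)) * Real.exp (-(2 * Real.log ‖x‖)) * (2 * ((n : ℝ) - 1)) :=
    by positivity
  refine nonpos_of_mul_nonpos_right ?_ hpos
  linarith

end ScalarCurvature

/-! ### Riemannian distance and completeness. -/

section Completeness

theorem tangentLength_conformalMetric {n : ℕ} (w : RSpace n → ℝ) (x v : RSpace n) :
    tangentLength (conformalMetric w) x v = ENNReal.ofReal (Real.exp (w x)) * ‖v‖ₑ := by
  have h : ∑ i, ∑ j, conformalMetric w x i j * v i * v j = (Real.exp (w x) * ‖v‖) ^ 2 := by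
    simp only [conformalMetric, Matrix.smul_apply, Matrix.one_apply, smul_eq_mul, mul_ite, mul_one,
      mul_zero, ite_mul, zero_mul, Finset.sum_ite_eq, Finset.mem_univ, if_true]
    rw [mul_pow, EuclideanSpace.real_norm_sq_eq, Finset.mul_sum, two_mul, Real.exp_add]
    exact Finset.sum_congr rfl fun i _ => by ring
  rw [tangentLength, h, Real.sqrt_sq (by positivity), ENNReal.ofReal_mul (Real.exp_pos _).le,
    ofReal_norm]

theorem tangentLength_smul {n : ℕ} (w : RSpace n → ℝ) (x : RSpace n) (c : ℝ) (v : RSpace n) :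
    tangentLength (conformalMetric w) x (c • v) = ‖c‖ₑ * tangentLength (conformalMetric w) x v := by
  rw [tangentLength_conformalMetric, tangentLength_conformalMetric, enorm_smul]
  ring

/-- A function whose differential has norm at most one for `e^{2w} g₀` is 1-Lipschitz for its
Riemannian distance. -/
theorem enorm_sub_le_metricEDist {n : ℕ} {w : RSpace n → ℝ} {ψ : RSpace n → ℝ}
    (hψ : ContDiff ℝ 1 ψ) (hb : ∀ y, ‖fderiv ℝ ψ y‖ ≤ Real.exp (w y)) (x y : RSpace n) :
    ‖ψ y - ψ x‖ₑ ≤ metricEDist (conformalMetric w) x y := by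
  let _ : ∀ z : RSpace n, ENorm (TangentSpace 𝓘(ℝ, RSpace n) z) :=
    fun z => ⟨fun v => tangentLength (conformalMetric w) z v⟩
  refine le_of_forall_gt fun r hr => ?_
  obtain ⟨γ, h0, h1, hγ, hlen⟩ := Manifold.exists_lt_of_riemannianEDist_lt hr
  refine lt_of_le_of_lt ?_ hlen
  rw [contMDiffOn_iff_contDiffOn] at hγ
  rw [Manifold.pathELength_eq_lintegral_mfderivWithin_Icc, ← h0, ← h1]
  refine (enorm_sub_le_lintegral_derivWithin_Icc_of_contDiffOn_Icc
    (hψ.comp_contDiffOn hγ) zero_le_one).trans ?_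
  refine setLIntegral_mono' measurableSet_Icc fun t ht => ?_
  have hd := (hγ t ht).differentiableWithinAt one_ne_zero
  have hu := uniqueDiffOn_Icc (zero_lt_one' ℝ) t ht
  rw [fderivWithin_derivWithin.symm, fderiv_comp_fderivWithin t
    (hψ.differentiable one_ne_zero _) hd hu]
  change ‖fderiv ℝ ψ (γ t) (fderivWithin ℝ γ (Set.Icc 0 1) t 1)‖ₑ ≤
    tangentLength (conformalMetric w) (γ t) (mfderivWithin 𝓘(ℝ, ℝ) 𝓘(ℝ, RSpace n) γ (Set.Icc 0 1) t
      (1 : ℝ))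
  rw [mfderivWithin_eq_fderivWithin]
  refine le_trans ?_ (tangentLength_conformalMetric w (γ t)
    (fderivWithin ℝ γ (Set.Icc 0 1) t (1 : ℝ))).ge
  refine ((fderiv ℝ ψ (γ t)).le_opENorm _).trans ?_
  refine mul_le_mul_left ?_ _
  rw [← ofReal_norm]
  exact ENNReal.ofReal_le_ofReal (hb _)

/-- The length of a radial segment, in the variable `log r`, bounds the distance. -/
theorem metricEDist_radial_le {n : ℕ} (w : RSpace n → ℝ) (e : RSpace n) (he : ‖e‖ = 1) {s t : ℝ}
    (hst : s ≤ t) :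
    metricEDist (conformalMetric w) (Real.exp s • e) (Real.exp t • e) ≤
      ∫⁻ τ in Set.Icc s t, ENNReal.ofReal (Real.exp (w (Real.exp τ • e) + τ)) := by
  let _ : ∀ z : RSpace n, ENorm (TangentSpace 𝓘(ℝ, RSpace n) z) :=
    fun z => ⟨fun v => tangentLength (conformalMetric w) z v⟩
  have _ : ∀ z : RSpace n, ENormSMulClass ℝ (TangentSpace 𝓘(ℝ, RSpace n) z) := fun z =>
    ⟨fun c v => tangentLength_smul w z c v⟩
  have hγ : ContDiff ℝ 1 fun τ : ℝ => Real.exp τ • e := by fun_prop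
  refine (Manifold.riemannianEDist_le_pathELength (γ := fun τ : ℝ => Real.exp τ • e) (a := s)
    (b := t) hγ.contMDiff.contMDiffOn rfl rfl hst).trans ?_
  rw [Manifold.pathELength_eq_lintegral_mfderiv_Icc]
  refine setLIntegral_mono' measurableSet_Icc fun τ _ => ?_
  change tangentLength (conformalMetric w) _ (mfderiv 𝓘(ℝ, ℝ) 𝓘(ℝ, RSpace n) _ τ (1 : ℝ)) ≤ _
  have hd : HasFDerivAt (fun τ : ℝ => Real.exp τ • e) _ τ :=
    ((Real.hasDerivAt_exp τ).smul_const e).hasFDerivAt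
  rw [mfderiv_eq_fderiv]
  refine (tangentLength_conformalMetric w (Real.exp τ • e)
    (fderiv ℝ (fun τ : ℝ => Real.exp τ • e) τ (1 : ℝ))).trans_le ?_
  rw [hd.fderiv, Real.exp_add, ENNReal.ofReal_mul (Real.exp_pos _).le]
  simp [← ofReal_norm, norm_smul, he]

theorem metricEDist_comm {n : ℕ} (w : RSpace n → ℝ) (x y : RSpace n) :
    metricEDist (conformalMetric w) x y = metricEDist (conformalMetric w) y x := by
  let _ : ∀ z : RSpace n, ENorm (TangentSpace 𝓘(ℝ, RSpace n) z) :=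
    fun z => ⟨fun v => tangentLength (conformalMetric w) z v⟩
  have _ : ∀ z : RSpace n, ENormSMulClass ℝ (TangentSpace 𝓘(ℝ, RSpace n) z) := fun z =>
    ⟨fun c v => tangentLength_smul w z c v⟩
  exact Manifold.riemannianEDist_comm

/-- A sequence that converges for the distance of a conformal metric does not escape to infinity. -/
theorem not_tendsto_norm_atTop_of_tendsto_metricEDist {n : ℕ} {w : RSpace n → ℝ}
    (hw : Continuous w) {u : ℕ → RSpace n} {x : RSpace n}
    (hu : Tendsto (fun i => metricEDist (conformalMetric w) (u i) x) atTop (𝓝 0)) :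
    ¬ Tendsto (fun i => ‖u i‖) atTop atTop := by
  intro hinf
  -- If `M` bounds `e^{-w} ‖dχ‖`, then `χ / (M + 1)` is 1-Lipschitz for the metric, so points
  -- outside the support of `χ` are at distance at least `1 / (M + 1)` from `x`.
  obtain ⟨χ⟩ : Nonempty (ContDiffBump x) := ⟨⟨1, 2, one_pos, one_lt_two⟩⟩
  have hχ : ContDiff ℝ 1 χ := χ.contDiff
  obtain ⟨M, hM⟩ := (χ.hasCompactSupport.fderiv ℝ |>.smul_left
    (f := fun y => Real.exp (-w y))).exists_bound_of_continuous
    ((by fun_prop : Continuous fun y => Real.exp (-w y)).smul (hχ.continuous_fderiv one_ne_zero))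
  have hM0 : 0 ≤ M := (norm_nonneg _).trans (hM x)
  have hδ : 0 < (M + 1)⁻¹ := by positivity
  have hlow : ∀ i, u i ∉ tsupport χ →
      ENNReal.ofReal (M + 1)⁻¹ ≤ metricEDist (conformalMetric w) (u i) x := by
    intro i hi
    have h := enorm_sub_le_metricEDist (w := w) (ψ := fun y => (M + 1)⁻¹ * χ y)
      (contDiff_const.mul hχ) (fun y => ?_) (u i) x
    · have h1 : χ (u i) = 0 := image_eq_zero_of_notMem_tsupport hi
      have h2 : χ x = 1 := χ.one_of_mem_closedBall (Metric.mem_closedBall_self χ.rIn_pos.le)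
      rw [h1, h2, mul_one, mul_zero, sub_zero, ← ofReal_norm, Real.norm_of_nonneg hδ.le] at h
      exact h
    · rw [fderiv_const_mul (hχ.differentiable one_ne_zero y), norm_smul, Real.norm_of_nonneg hδ.le,
        inv_mul_le_iff₀ (by positivity)]
      have h1 : Real.exp (-w y) * ‖fderiv ℝ χ y‖ ≤ M := by
        simpa [norm_smul] using hM y
      have h2 : ‖fderiv ℝ χ y‖ = Real.exp (w y) * (Real.exp (-w y) * ‖fderiv ℝ χ y‖) := by
        rw [← mul_assoc, ← Real.exp_add]; simp
      rw [h2, mul_comm (M + 1)]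
      exact mul_le_mul_of_nonneg_left (by linarith) (Real.exp_pos _).le
  have hesc : ∀ᶠ i in atTop, u i ∉ tsupport χ := by
    obtain ⟨R, hR⟩ := χ.hasCompactSupport.isCompact.isBounded.exists_norm_le
    filter_upwards [hinf.eventually_gt_atTop R] with i hi hmem
    exact absurd (hR _ hmem) (not_le.2 hi)
  obtain ⟨i, h1, h2⟩ := (hesc.and
    (hu.eventually_lt_const (ENNReal.ofReal_pos.2 hδ))).exists
  exact absurd (hlow i h1) (not_le.2 h2)

/-- Completeness forbids the logarithmic derivative to converge to a number below `-1`. -/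
theorem neg_one_le_of_isCompleteMetric {n : ℕ} {w : RSpace n → ℝ} (hw : Continuous w)
    (hc : IsCompleteMetric (conformalMetric w)) {e : RSpace n} (he : ‖e‖ = 1) {V V' : ℝ → ℝ}
    (hV : ∀ t, V t = w (Real.exp t • e)) (hV' : ∀ t, HasDerivAt V (V' t) t) {l : ℝ}
    (hl : Tendsto V' atTop (𝓝 l)) : -1 ≤ l := by
  by_contra! hlt
  obtain ⟨c, hc0, hcl⟩ : ∃ c : ℝ, 0 < c ∧ l < -1 - c := ⟨(-1 - l) / 2, by linarith, by linarith⟩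
  obtain ⟨T, hT⟩ := eventually_atTop.1 (hl.eventually_lt_const hcl)
  -- This bounds the length density `e^{V + t}` of the ray by `e^K e^{-ct}`, which is integrable at
  -- infinity.
  have hanti : AntitoneOn (fun t => V t + (1 + c) * t) (Set.Ici T) := by
    have hd : ∀ t, HasDerivAt (fun t => V t + (1 + c) * t) (V' t + (1 + c)) t := fun t =>
      ((hV' t).add ((hasDerivAt_id t).const_mul (1 + c))).congr_deriv (by simp)
    refine antitoneOn_of_hasDerivWithinAt_nonpos (convex_Ici T)
      (fun t _ => (hd t).continuousAt.continuousWithinAt) (fun t _ => (hd t).hasDerivWithinAt) ?_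
    intro t ht
    rw [interior_Ici] at ht
    linarith [hT t (le_of_lt ht)]
  set K := V T + (1 + c) * T
  have hdist : ∀ s t, T ≤ s → s ≤ t →
      metricEDist (conformalMetric w) (Real.exp s • e) (Real.exp t • e) ≤
        ENNReal.ofReal (Real.exp K * (-Real.exp (-c * s) / -c)) := by
    intro s t hs hst
    refine (metricEDist_radial_le w e he hst).trans ?_
    have hle : ∫⁻ τ in Set.Icc s t, ENNReal.ofReal (Real.exp (w (Real.exp τ • e) + τ)) ≤
        ∫⁻ τ in Set.Icc s t, ENNReal.ofReal (Real.exp K * Real.exp (-c * τ)) := by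
      refine setLIntegral_mono' measurableSet_Icc fun τ hτ => ENNReal.ofReal_le_ofReal ?_
      rw [← Real.exp_add, Real.exp_le_exp, ← hV]
      have h1 : V τ + (1 + c) * τ ≤ K :=
        hanti (Set.mem_Ici.2 le_rfl) (Set.mem_Ici.2 (hs.trans hτ.1)) (hs.trans hτ.1)
      linarith
    refine hle.trans ((lintegral_mono_set Set.Icc_subset_Ici_self).trans_eq ?_)
    rw [setLIntegral_congr Ioi_ae_eq_Ici.symm, ← ofReal_integral_eq_lintegral_ofReal,
      integral_const_mul, integral_exp_mul_Ioi (by linarith)]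
    · exact (integrableOn_exp_mul_Ioi (by linarith) s).const_mul _
    · exact Eventually.of_forall fun τ => by positivity
  have htail : Tendsto (fun s => ENNReal.ofReal (Real.exp K * (-Real.exp (-c * s) / -c)))
      atTop (𝓝 0) := by
    have h1 := ((tendsto_exp_neg_mul hc0).div_const c).const_mul (Real.exp K)
    have h2 := ENNReal.tendsto_ofReal h1
    simpa using h2
  -- Points on a ray of finite length form a Cauchy sequence that leaves every compact set.
  obtain ⟨x, hx⟩ := hc (fun k => Real.exp (k : ℝ) • e) fun ε hε => by
    obtain ⟨S, hS⟩ := eventually_atTop.1 (htail.eventually_lt_const hε)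
    obtain ⟨N, hN⟩ := exists_nat_ge (max S T)
    have key : ∀ i ≥ N, ∀ j ≥ i, metricEDist (conformalMetric w) (Real.exp (i : ℝ) • e)
        (Real.exp (j : ℝ) • e) < ε := by
      intro i hi j hj
      have h1 : max S T ≤ (i : ℝ) := hN.trans (by exact_mod_cast hi)
      exact (hdist i j ((le_max_right _ _).trans h1) (by exact_mod_cast hj)).trans_lt
        (hS _ ((le_max_left _ _).trans h1))
    refine ⟨N, fun i hi j hj => ?_⟩
    rcases le_total i j with hij | hij
    · exact key i hi j hij
    · rw [metricEDist_comm]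
      exact key j hj i hij
  refine not_tendsto_norm_atTop_of_tendsto_metricEDist hw hx ?_
  simp only [norm_smul, he, mul_one, Real.norm_eq_abs, Real.abs_exp]
  exact Real.tendsto_exp_atTop.comp tendsto_natCast_atTop_atTop

end Completeness

/-! ### The bound on the total `Q`-curvature. -/

theorem mainTheorem4 (m : ℕ) (hm : 1 ≤ m) (w : RSpace (2 * m) → ℝ)
    (hsmooth : ContDiff ℝ ∞ w)
    (hradial : ∀ x y : RSpace (2 * m), ‖x‖ = ‖y‖ → w x = w y)
    (hcomplete : IsCompleteMetric (conformalMetric w))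
    (hscalar : ∀ᶠ x in cocompact (RSpace (2 * m)), 0 ≤ scalarCurvature (conformalMetric w) x)
    (hint : Integrable (qCurvature m w) (riemannianVolume (conformalMetric w))) :
    gaussBonnetConst (2 * m) *
        ∫ x, qCurvature m w x ∂(riemannianVolume (conformalMetric w)) ≤ 1 := by
  obtain ⟨N, rfl⟩ : ∃ N, m = N + 1 := ⟨m - 1, by lia⟩
  obtain ⟨e, he⟩ : ∃ e : RSpace (2 * (N + 1)), ‖e‖ = 1 :=
    ⟨EuclideanSpace.single ⟨0, by lia⟩ 1, by simp⟩
  set φ : smoothFunctions := ⟨fun r => w (r • e),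
    (hsmooth.comp (contDiff_id.smul contDiff_const) : ContDiff ℝ ∞ fun r : ℝ => w (r • e))⟩
  set V : smoothFunctions := ⟨fun t => w (Real.exp t • e),
    (hsmooth.comp (Real.contDiff_exp.smul contDiff_const) :
      ContDiff ℝ ∞ fun t : ℝ => w (Real.exp t • e))⟩ with hVdef
  have hV : ∀ x ≠ 0, w x = V.1 (Real.log ‖x‖) := fun x hx =>
    hradial _ _ (by simp [norm_smul, he, Real.exp_log (norm_pos_iff.2 hx)])
  have hnorm : ∀ t : ℝ, ‖Real.exp t • e‖ = Real.exp t := fun t => by simp [norm_smul, he]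
  obtain ⟨L, hL, hQ⟩ := exists_tendsto_and_integral_qCurvature hsmooth.continuous
    (φ := φ) (V := V) (fun _ => rfl) hV hint
  have hesc : Tendsto (fun t : ℝ => Real.exp t • e) atTop (cocompact _) := by
    refine tendsto_cocompact_of_tendsto_dist_comp_atTop 0 ?_
    simpa [hnorm] using Real.tendsto_exp_atTop
  have hR : ∀ᶠ t in atTop, (smoothDeriv (smoothDeriv V)).1 t + 2 * N * (smoothDeriv V).1 t
      + N * (smoothDeriv V).1 t ^ 2 ≤ 0 := by
    filter_upwards [hesc.eventually hscalar] with t ht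
    have h0 : Real.exp t • e ≠ 0 := by
      rw [← norm_pos_iff, hnorm]
      exact Real.exp_pos t
    have h := riccati_of_scalarCurvature_nonneg (by lia) hsmooth hV h0 ht
    rw [hnorm, Real.log_exp] at h
    have hN : (((2 * (N + 1) : ℕ) : ℝ) - 2) / 2 = N := by
      push_cast
      ring
    rwa [hN] at h
  -- For `N = 0` the Riccati inequality gives no bound on `V'`, but there is then no growing mode to
  -- exclude.
  have hgrowth : ∀ i < N, Tendsto (fun t => Real.exp (-(2 * ((i : ℝ) + 1) * t)) *
      (smoothDeriv V).1 t) atTop (𝓝 0) := by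
    intro i hi
    obtain ⟨C, hC⟩ := exists_eventually_abs_le_of_riccati
      (Nat.cast_pos.2 (Nat.zero_lt_of_lt hi)) (smoothFunctions_hasDerivAt V)
      (smoothFunctions_hasDerivAt (smoothDeriv V)) hR
    exact (tendsto_exp_neg_mul (by positivity)).zero_mul_isBoundedUnder_le
      (isBoundedUnder_of_eventually_le hC)
  have hlim := tendsto_of_tendsto_shiftProd_mul_reflProd N (smoothDeriv V) hgrowth hL
  have hge := neg_one_le_of_isCompleteMetric hsmooth.continuous hcomplete he (fun _ => rfl)
    (smoothFunctions_hasDerivAt V) hlim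
  have hE : 0 < evenProd N ^ 2 := pow_pos (evenProd_pos N) 2
  rw [le_div_iff₀ hE] at hge
  have hS : 0 ≤ unitSphereVolume (2 * (N + 1)) := measureReal_nonneg
  rw [hQ, gaussBonnetConst, show 2 * (N + 1) - 2 = 2 * N by lia, ← evenProd_eq_doubleFactorial,
    one_div_mul_eq_div]
  refine div_le_one_of_le₀ ?_ (mul_nonneg hE.le hS)
  nlinarith
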